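/- Let $E=(1,0)$, $D=(1,1)$, $N=(0,1)$, and let $n,l$ be integers with $0\le n\le l$. A Schröder $n$-path with $l$ steps is a lattice path from $(0,0)$ to $(n,n)$ consisting of $l$ steps from $\{E,D,N\}$ that never goes above the line $y=x$; it is identified with the word $W=w_1w_2\cdots w_l$ of its steps, and $\mathrm{Sch}_L(n,l)$ denotes the set of all these paths. Fix any linear order on $\{E,D,N\}$ (any of the six). The major index of $W$ is $\mathrm{maj}(W)=\sum i$, the sum being over all $i$ with $1\le i\le l-1$ and $w_i>w_{i+1}$. For an indeterminate $q$ put $[m]=1+q+\cdots+q^{m-1}$, $[m]!=[1][2]\cdots[m]$, and $\begin{bmatrix}m\\k\end{bmatrix}=\dfrac{[m]!}{[k]!\,[m-k]!}$ if $0\le k\le m$, and $\begin{bmatrix}m\\k\end{bmatrix}=0$ for every other integer $k$. Then, in $\mathbb{Q}(q)$, $$\sum_{W\in \mathrm{Sch}_L(n,l)}q^{\mathrm{maj}(W)}=\frac{1}{[l-n+1]}\begin{bmatrix}2(l-n)\\l-n\end{bmatrix}\begin{bmatrix}l\\2n-l\end{bmatrix}\quad\text{if }E<N,$$ and $$\sum_{W\in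 \mathrm{Sch}_L(n,l)}q^{\mathrm{maj}(W)}=\frac{q^{\,l-n}}{[l-n+1]}\begin{bmatrix}2(l-n)\\l-n\end{bmatrix}\begin{bmatrix}l\\2n-l\end{bmatrix}\quad\text{if }E>N.$$ -/

import Mathlib

namespace Schroeder

/-- The three step letters: `E` is the step (1,0), `D` is (1,1), `N` is (0,1). -/
inductive Step : Type
  | E : Step
  | D : Step
  | N : Step

instance : Fintype Step where
  elems := ⟨[Step.E, Step.D, Step.N], by simp⟩
  complete := by intro s; cases s <;> simp

/-- The displacement of a step. -/
def Step.vec : Step → ℤ × ℤ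
  | Step.E => (1, 0)
  | Step.D => (1, 1)
  | Step.N => (0, 1)

/-- The lattice point reached from (0,0) after the first `i` steps of the word `W`. The letters
`w₁, …, w_l` of the word are `W 0, …, W (l - 1)`. -/
def pos {l : ℕ} (W : Fin l → Step) (i : ℕ) : ℤ × ℤ :=
  ∑ j : Fin l, if (j : ℕ) < i then (W j).vec else 0

/-- Delannoy paths with `l` steps from (0,0) to `(m, n)`. -/
def Del (m n l : ℕ) : Finset (Fin l → Step) :=
  {W | pos W l = ((m : ℤ), (n : ℤ))}

/-- Schröder `n`-paths with `l` steps: Delannoy paths from (0,0) to `(n, n)` that never go above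
the line `y = x`. -/
def Sch (n l : ℕ) : Finset (Fin l → Step) :=
  (Del n n l).filter fun W => ∀ i : Fin (l + 1), (pos W i).2 ≤ (pos W i).1

/-- The descents of `W = w₁ ⋯ w_l`: the positions `i`, `1 ≤ i ≤ l - 1`, with `w_i > w_{i+1}`.
Here `a` and `b` are the zero-based indices of `w_i` and `w_{i+1}`. -/
def descents [LinearOrder Step] {l : ℕ} (W : Fin l → Step) : Finset ℕ :=
  {i ∈ Finset.Icc 1 (l - 1) | ∃ a b : Fin l, (a : ℕ) + 1 = i ∧ (b : ℕ) = i ∧ W b < W a}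

/-- The major index: the sum of the descents. -/
def maj [LinearOrder Step] {l : ℕ} (W : Fin l → Step) : ℕ :=
  ∑ i ∈ descents W, i

/-- The generating function of the major index over Schröder `n`-paths with `l` steps, an element
of the field `ℚ(q)` of rational functions in the indeterminate `q = RatFunc.X`. -/
noncomputable def MSch [LinearOrder Step] (n l : ℕ) : RatFunc ℚ :=
  ∑ W ∈ Sch n l, RatFunc.X ^ maj W

/-- The `q`-integer `[m] = 1 + q + ⋯ + q^(m-1)`. -/
noncomputable def qInt (m : ℕ) : RatFunc ℚ :=
  ∑ i ∈ Finset.range m, RatFunc.X ^ i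

/-- The `q`-factorial `[m]! = [1][2]⋯[m]`. -/
noncomputable def qFactorial (m : ℕ) : RatFunc ℚ :=
  ∏ i ∈ Finset.Icc 1 m, qInt i

/-- The `q`-binomial coefficient `[m]! / ([k]! [m-k]!)` for `0 ≤ k ≤ m`, with the usual convention
that it is zero for an integer `k` outside this range. -/
noncomputable def qBinom (m : ℕ) (k : ℤ) : RatFunc ℚ :=
  if 0 ≤ k ∧ k ≤ m then
    qFactorial m / (qFactorial k.toNat * qFactorial (m - k.toNat))
  else 0

end Schroeder

namespace Schroeder
open RatFunc

/-! A word counted here has `e = l - n` letters `E`, `e` letters `N` and `d = 2n - l` letters `D`.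
Deleting its last letter changes `maj` by an amount that depends only on the last two letters, so
the sums refined by last letter satisfy a linear recurrence. The letters `D` do not affect the
ballot condition, and inserting them multiplies the sum by `qMultichoose (e + e) d`, wherever `D`
stands in the order (`sum_contentSum_eq_mul`). The refined version `DFactors` is what the induction
carries; it rests on the two q-Pascal rules. For words in `E` and `N` alone, the total over last
letters satisfies the three-term recurrence of the q-binomials. So does `qBallot c`, a difference of
two q-binomials as in the reflection principle; the boundary at the diagonal forces `c = q` if `E <
N` and `c = 1` if `N < E`. On the diagonal `qBallot c` becomes the q-Catalan number, with the extra
factor `q ^ e` in the second case. -/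

/-- The last letter of a word, if there is one. -/
def lastStep : {l : ℕ} → (Fin l → Step) → Option Step
  | 0, _ => none
  | l + 1, W => some (W (Fin.last l))

/-- The factor by which a letter `x`, put in position `l + 1` after the letter `o`, multiplies
`q ^ maj`. -/
noncomputable def descentWeight [LinearOrder Step] (o : Option Step) (x : Step) (l : ℕ) :
    RatFunc ℚ :=
  match o with
  | none => 1
  | some y => if x < y then X ^ l else 1

/-- A word stays weakly below the diagonal. -/
def IsBallot {l : ℕ} (W : Fin l → Step) : Prop :=
  ∀ i ≤ l, (pos W i).2 ≤ (pos W i).1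

open Classical in
/-- The generating function of the major index over ballot words with `l` letters, end point `p`
and last letter `o`. -/
noncomputable def ballotSum [LinearOrder Step] (l : ℕ) (p : ℤ × ℤ) (o : Option Step) :
    RatFunc ℚ :=
  ∑ W : Fin l → Step, if pos W l = p ∧ IsBallot W ∧ lastStep W = o then X ^ maj W else 0

/-! ### Deleting the last letter of a word -/

lemma pos_snoc_of_le {l : ℕ} (W : Fin l → Step) (x : Step) {i : ℕ} (hi : i ≤ l) :
    pos (Fin.snoc W x : Fin (l + 1) → Step) i = pos W i := by
  simp [pos, Fin.sum_univ_castSucc, hi]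

lemma pos_snoc_last {l : ℕ} (W : Fin l → Step) (x : Step) :
    pos (Fin.snoc W x : Fin (l + 1) → Step) (l + 1) = pos W l + x.vec := by
  simp [pos, Fin.sum_univ_castSucc]

lemma isBallot_snoc {l : ℕ} (W : Fin l → Step) (x : Step) :
    IsBallot (Fin.snoc W x : Fin (l + 1) → Step) ↔
      IsBallot W ∧ (pos W l + x.vec).2 ≤ (pos W l + x.vec).1 := by
  constructor
  · intro h
    refine ⟨fun i hi => ?_, ?_⟩
    · simpa [pos_snoc_of_le W x hi] using h i (by omega)
    · simpa only [pos_snoc_last] using h (l + 1) le_rfl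
  · rintro ⟨h, h'⟩ i hi
    rcases Nat.lt_or_ge l i with hl | hl
    · obtain rfl : i = l + 1 := by omega
      simpa only [pos_snoc_last] using h'
    · rw [pos_snoc_of_le W x hl]
      exact h i hl

lemma sum_Icc_one_eq_sum_fin {M : Type*} [AddCommMonoid M] (f : ℕ → M) (l : ℕ) :
    ∑ i ∈ Finset.Icc 1 l, f i = ∑ i : Fin l, f (i + 1) := by
  induction l with
  | zero => simp
  | succ l ih => simp [Finset.sum_Icc_succ_top, Fin.sum_univ_castSucc, ih]

lemma maj_eq_sum [LinearOrder Step] {l : ℕ} (W : Fin (l + 1) → Step) :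
    maj W = ∑ i : Fin l, if W i.succ < W i.castSucc then (i : ℕ) + 1 else 0 := by
  have h : ∀ i : Fin l,
      (∃ a b : Fin (l + 1), (a : ℕ) + 1 = (i : ℕ) + 1 ∧ (b : ℕ) = (i : ℕ) + 1 ∧ W b < W a) ↔
        W i.succ < W i.castSucc := by
    intro i
    constructor
    · rintro ⟨a, b, ha, hb, hab⟩
      obtain rfl : a = i.castSucc := Fin.ext (by simpa using ha)
      obtain rfl : b = i.succ := Fin.ext (by simpa using hb)
      exact hab
    · exact fun hi => ⟨i.castSucc, i.succ, by simp, by simp, hi⟩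
  rw [maj, descents, Finset.sum_filter, Nat.add_sub_cancel,
    sum_Icc_one_eq_sum_fin]
  simp only [h]

lemma maj_snoc [LinearOrder Step] {l : ℕ} (W : Fin l → Step) (x : Step) :
    (X : RatFunc ℚ) ^ maj (Fin.snoc W x : Fin (l + 1) → Step) =
      descentWeight (lastStep W) x l * X ^ maj W := by
  cases l with
  | zero => simp [descentWeight, lastStep, maj, descents]
  | succ l =>
    rw [maj_eq_sum, maj_eq_sum, Fin.sum_univ_castSucc]
    have h : ∀ i : Fin l, (Fin.snoc W x : Fin (l + 2) → Step) i.castSucc.succ = W i.succ := by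
      intro i
      rw [Fin.succ_castSucc, Fin.snoc_castSucc]
    simp only [h, Fin.snoc_castSucc, Fin.succ_last, Fin.snoc_last, Fin.val_castSucc, Fin.val_last]
    simp only [descentWeight, lastStep]
    split_ifs <;> simp [pow_add, mul_comm]

lemma ballotSum_succ [LinearOrder Step] (l : ℕ) (p : ℤ × ℤ) (x : Step) :
    ballotSum (l + 1) p (some x) =
      if p.2 ≤ p.1 then
        ∑ o : Option Step, descentWeight o x l * ballotSum l (p - x.vec) o else 0 := by
  classical
  have hsum : ballotSum (l + 1) p (some x) = ∑ W : Fin l → Step,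
      if pos W l = p - x.vec ∧ IsBallot W ∧ p.2 ≤ p.1 then
        descentWeight (lastStep W) x l * X ^ maj W else 0 := by
    rw [ballotSum, ← (Fin.snocEquiv fun _ => Step).sum_comp, Fintype.sum_prod_type,
      Finset.sum_eq_single x]
    · refine Finset.sum_congr rfl fun W _ => ?_
      have hW : (Fin.snocEquiv fun _ => Step) (x, W) = (Fin.snoc W x : Fin (l + 1) → Step) := rfl
      rw [hW, maj_snoc]
      refine if_congr ?_ rfl rfl
      rw [pos_snoc_last, isBallot_snoc]
      simp only [lastStep, Fin.snoc_last, and_true, eq_sub_iff_add_eq]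
      constructor
      · rintro ⟨rfl, h, h'⟩
        exact ⟨rfl, h, h'⟩
      · rintro ⟨rfl, h, h'⟩
        exact ⟨rfl, h, h'⟩
    · intro y _ hy
      refine Finset.sum_eq_zero fun W _ => if_neg ?_
      rintro ⟨-, -, h⟩
      have hW : (Fin.snocEquiv fun _ => Step) (y, W) = (Fin.snoc W y : Fin (l + 1) → Step) := rfl
      rw [hW] at h
      simp only [lastStep, Fin.snoc_last, Option.some.injEq] at h
      exact hy h
    · simp
  rw [hsum]
  split_ifs with hp
  · simp only [ballotSum, Finset.mul_sum]
    rw [Finset.sum_comm]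
    refine Finset.sum_congr rfl fun W _ => ?_
    rw [Finset.sum_eq_single (lastStep W)]
    · simp [hp]
    · intro o _ ho
      simp [ho.symm]
    · simp
  · simp [hp]

lemma ballotSum_eq_zero_of_lt [LinearOrder Step] {l : ℕ} {p : ℤ × ℤ} (hp : p.1 < p.2)
    (o : Option Step) : ballotSum l p o = 0 := by
  refine Finset.sum_eq_zero fun W _ => if_neg ?_
  rintro ⟨rfl, h, -⟩
  exact absurd (h l le_rfl) (by omega)

lemma ballotSum_zero [LinearOrder Step] (p : ℤ × ℤ) (o : Option Step) :
    ballotSum 0 p o = if p = 0 ∧ o = none then 1 else 0 := by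
  classical
  simp [ballotSum, pos, IsBallot, lastStep, maj, descents, eq_comm]

lemma ballotSum_succ_none [LinearOrder Step] (l : ℕ) (p : ℤ × ℤ) :
    ballotSum (l + 1) p none = 0 := by
  simp [ballotSum, lastStep]

/-- The slacks in the three inequalities are the numbers of letters `N`, `E` and `D`. -/
lemma pos_bounds {l : ℕ} (W : Fin l → Step) :
    (pos W l).1 ≤ l ∧ (pos W l).2 ≤ l ∧ l ≤ (pos W l).1 + (pos W l).2 := by
  have h : pos W l = ∑ j, (W j).vec := by simp [pos]
  have h1 : ∀ x : Step, x.vec.1 ≤ 1 := by rintro (_ | _ | _) <;> simp [Step.vec]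
  have h2 : ∀ x : Step, x.vec.2 ≤ 1 := by rintro (_ | _ | _) <;> simp [Step.vec]
  have h3 : ∀ x : Step, 1 ≤ x.vec.1 + x.vec.2 := by rintro (_ | _ | _) <;> simp [Step.vec]
  rw [h, Prod.fst_sum, Prod.snd_sum, ← Finset.sum_add_distrib]
  refine ⟨?_, ?_, ?_⟩
  · simpa using Finset.sum_le_card_nsmul Finset.univ _ 1 fun j _ => h1 (W j)
  · simpa using Finset.sum_le_card_nsmul Finset.univ _ 1 fun j _ => h2 (W j)
  · simpa using Finset.card_nsmul_le_sum Finset.univ _ 1 fun j _ => h3 (W j)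

lemma ballotSum_eq_zero [LinearOrder Step] {l : ℕ} {p : ℤ × ℤ}
    (hp : ¬ (p.1 ≤ l ∧ p.2 ≤ l ∧ l ≤ p.1 + p.2)) (o : Option Step) : ballotSum l p o = 0 := by
  refine Finset.sum_eq_zero fun W _ => if_neg ?_
  rintro ⟨rfl, -, -⟩
  exact hp (pos_bounds W)

lemma MSch_eq_sum_ballotSum [LinearOrder Step] (n l : ℕ) :
    MSch n l = ∑ o : Option Step, ballotSum l (n, n) o := by
  classical
  simp only [ballotSum]
  rw [Finset.sum_comm, MSch, Sch, Del, Finset.sum_filter, Finset.sum_filter]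
  refine Finset.sum_congr rfl fun W _ => ?_
  have hW : (∀ i : Fin (l + 1), (pos W i).2 ≤ (pos W i).1) ↔ IsBallot W :=
    ⟨fun h i hi => h ⟨i, by omega⟩, fun h i => h i (by omega)⟩
  rw [Finset.sum_eq_single (lastStep W)]
  · simp [hW, ite_and]
  · intro o _ ho
    simp [ho.symm]
  · simp

/-- The generating function of the major index over ballot words with `a` letters `E`, `b` letters
`N`, `d` letters `D`, and last letter `o`. -/
noncomputable def contentSum [LinearOrder Step] (o : Option Step) (a b d : ℕ) : RatFunc ℚ :=
  ballotSum (a + b + d) ((a : ℤ) + d, (b : ℤ) + d) o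

/-! ### Recurrences in terms of letter counts -/

section Recurrence

open Step

lemma sum_option_step (f : Option Step → RatFunc ℚ) :
    ∑ o, f o = f none + f (some E) + f (some N) + f (some D) := by
  rw [Fintype.sum_option]
  have : (Finset.univ : Finset Step).val = {E, D, N} := rfl
  simp only [Finset.sum, this]
  simp
  ring

variable [LinearOrder Step]

lemma contentSum_eq_zero {a b : ℕ} (h : a < b) (o : Option Step) (d : ℕ) :
    contentSum o a b d = 0 :=
  ballotSum_eq_zero_of_lt (by simpa using h) o

lemma contentSum_none {a b d : ℕ} (h : a + b + d ≠ 0) : contentSum none a b d = 0 := by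
  obtain ⟨l, hl⟩ := Nat.exists_eq_succ_of_ne_zero h
  rw [contentSum, hl, ballotSum_succ_none]

lemma contentSum_zero (o : Option Step) : contentSum o 0 0 0 = if o = none then 1 else 0 := by
  simp [contentSum, ballotSum_zero]

lemma contentSum_E_zero (b d : ℕ) : contentSum (some E) 0 b d = 0 := by
  rw [contentSum]
  rcases hl : 0 + b + d with _ | l
  · simp [ballotSum_zero]
  · rw [ballotSum_succ]
    have hp := ballotSum_eq_zero (l := l) (p := (((0 : ℕ) : ℤ) + d, (b : ℤ) + d) - E.vec)
      (by simp [Step.vec]; omega)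
    simp only [hp, mul_zero, Finset.sum_const_zero, ite_self]

lemma contentSum_N_zero (a d : ℕ) : contentSum (some N) a 0 d = 0 := by
  rw [contentSum]
  rcases hl : a + 0 + d with _ | l
  · simp [ballotSum_zero]
  · rw [ballotSum_succ]
    have hp := ballotSum_eq_zero (l := l) (p := ((a : ℤ) + d, ((0 : ℕ) : ℤ) + d) - N.vec)
      (by simp [Step.vec]; omega)
    simp only [hp, mul_zero, Finset.sum_const_zero, ite_self]

lemma contentSum_D_zero (a b : ℕ) : contentSum (some D) a b 0 = 0 := by
  rw [contentSum]
  rcases hl : a + b + 0 with _ | l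
  · simp [ballotSum_zero]
  · rw [ballotSum_succ]
    have hp := ballotSum_eq_zero (l := l) (p := ((a : ℤ) + (0 : ℕ), (b : ℤ) + (0 : ℕ)) - D.vec)
      (by simp [Step.vec]; omega)
    simp only [hp, mul_zero, Finset.sum_const_zero, ite_self]

/-- No ballot condition is needed: if the new end point is above the diagonal, so is the old one,
and both sides vanish. -/
lemma contentSum_E_succ (a b d : ℕ) :
    contentSum (some E) (a + 1) b d =
      ∑ o, descentWeight o E (a + b + d) * contentSum o a b d := by
  simp only [contentSum]
  rw [show a + 1 + b + d = a + b + d + 1 by omega, ballotSum_succ]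
  have hp : (((a + 1 : ℕ) : ℤ) + d, (b : ℤ) + d) - E.vec = ((a : ℤ) + d, (b : ℤ) + d) := by
    ext <;> simp [Step.vec]; ring
  rw [hp]
  split_ifs with h
  · rfl
  · refine (Finset.sum_eq_zero fun o _ => ?_).symm
    rw [ballotSum_eq_zero_of_lt (by simp at h ⊢; omega), mul_zero]

lemma contentSum_N_succ (a b d : ℕ) :
    contentSum (some N) a (b + 1) d =
      if b + 1 ≤ a then ∑ o, descentWeight o N (a + b + d) * contentSum o a b d else 0 := by
  simp only [contentSum]
  rw [show a + (b + 1) + d = a + b + d + 1 by omega, ballotSum_succ]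
  have hp : ((a : ℤ) + d, ((b + 1 : ℕ) : ℤ) + d) - N.vec = ((a : ℤ) + d, (b : ℤ) + d) := by
    ext <;> simp [Step.vec]; ring
  rw [hp]
  refine if_congr ?_ rfl rfl
  push_cast
  omega

lemma contentSum_D_succ (a b d : ℕ) :
    contentSum (some D) a b (d + 1) =
      ∑ o, descentWeight o D (a + b + d) * contentSum o a b d := by
  simp only [contentSum]
  rw [show a + b + (d + 1) = a + b + d + 1 by omega, ballotSum_succ]
  have hp : ((a : ℤ) + (d + 1 : ℕ), (b : ℤ) + (d + 1 : ℕ)) - D.vec =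
      ((a : ℤ) + d, (b : ℤ) + d) := by
    ext <;> simp [Step.vec] <;> ring
  rw [hp]
  split_ifs with h
  · rfl
  · refine (Finset.sum_eq_zero fun o _ => ?_).symm
    rw [ballotSum_eq_zero_of_lt (by simp at h ⊢; omega), mul_zero]

end Recurrence

/-! ### Arithmetic of q-binomials -/

lemma qInt_succ (m : ℕ) : qInt (m + 1) = qInt m + X ^ m := by
  rw [qInt, qInt, Finset.sum_range_succ]

lemma X_sub_one_mul_qInt (m : ℕ) : (X - 1) * qInt m = X ^ m - 1 := by
  rw [qInt, mul_comm, geom_sum_mul]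

lemma qInt_add (m n : ℕ) : qInt (m + n) = qInt m + X ^ m * qInt n := by
  simp [qInt, Finset.sum_range_add, pow_add, Finset.mul_sum]

lemma qInt_ne_zero {m : ℕ} (hm : m ≠ 0) : qInt m ≠ 0 := by
  have h : qInt m = algebraMap (Polynomial ℚ) (RatFunc ℚ) (∑ i ∈ Finset.range m, Polynomial.X ^ i) := by
    simp [qInt]
  rw [h]
  refine RatFunc.algebraMap_ne_zero fun h0 => ?_
  have := congrArg (Polynomial.eval 1) h0
  simp [Polynomial.eval_finsetSum] at this
  exact hm this

lemma qFactorial_succ (m : ℕ) : qFactorial (m + 1) = qFactorial m * qInt (m + 1) := by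
  rw [qFactorial, qFactorial, Finset.prod_Icc_succ_top (by omega)]

lemma qFactorial_ne_zero (m : ℕ) : qFactorial m ≠ 0 :=
  Finset.prod_ne_zero_iff.2 fun i hi => qInt_ne_zero (by simp at hi; omega)

/-- The `q`-binomial coefficient `[a + b]! / ([a]! [b]!)`. -/
noncomputable def qMultichoose (a b : ℕ) : RatFunc ℚ :=
  qFactorial (a + b) / (qFactorial a * qFactorial b)

lemma qMultichoose_zero_right (a : ℕ) : qMultichoose a 0 = 1 := by
  have h := qFactorial_ne_zero a
  have h0 : qFactorial 0 = 1 := by simp [qFactorial]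
  simp [qMultichoose, h, h0]

lemma qMultichoose_zero_left (b : ℕ) : qMultichoose 0 b = 1 := by
  have h := qFactorial_ne_zero b
  have h0 : qFactorial 0 = 1 := by simp [qFactorial]
  simp [qMultichoose, h, h0]

lemma qInt_mul_qMultichoose_left (a b : ℕ) :
    qInt (a + 1) * qMultichoose (a + 1) b = qInt (a + b + 1) * qMultichoose a b := by
  have ha := qFactorial_ne_zero a
  have hb := qFactorial_ne_zero b
  have hi := qInt_ne_zero (Nat.succ_ne_zero a)
  rw [qMultichoose, qMultichoose, show a + 1 + b = a + b + 1 by omega, qFactorial_succ,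
    qFactorial_succ]
  field_simp

lemma qInt_mul_qMultichoose_right (a b : ℕ) :
    qInt (b + 1) * qMultichoose a (b + 1) = qInt (a + b + 1) * qMultichoose a b := by
  have ha := qFactorial_ne_zero a
  have hb := qFactorial_ne_zero b
  have hi := qInt_ne_zero (Nat.succ_ne_zero b)
  rw [qMultichoose, qMultichoose, ← add_assoc, qFactorial_succ, qFactorial_succ]
  field_simp

lemma qMultichoose_succ_succ (a b : ℕ) :
    qMultichoose (a + 1) (b + 1) =
      qMultichoose (a + 1) b + X ^ (b + 1) * qMultichoose a (b + 1) := by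
  have hb := qInt_ne_zero (Nat.succ_ne_zero b)
  have h1 := qInt_mul_qMultichoose_right (a + 1) b
  have h2 := qInt_mul_qMultichoose_right a b
  have h3 := qInt_mul_qMultichoose_left a b
  have h4 := qInt_add (b + 1) (a + 1)
  rw [show b + 1 + (a + 1) = a + 1 + b + 1 by omega] at h4
  refine mul_left_cancel₀ hb ?_
  linear_combination h1 - X ^ (b + 1) * h2 + X ^ (b + 1) * h3 + qMultichoose (a + 1) b * h4

lemma qMultichoose_succ_succ' (a b : ℕ) :
    qMultichoose (a + 1) (b + 1) =
      X ^ (a + 1) * qMultichoose (a + 1) b + qMultichoose a (b + 1) := by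
  have ha := qInt_ne_zero (Nat.succ_ne_zero a)
  have h1 := qInt_mul_qMultichoose_left a (b + 1)
  have h2 := qInt_mul_qMultichoose_right a b
  have h3 := qInt_mul_qMultichoose_left a b
  have h4 := qInt_add (a + 1) (b + 1)
  rw [show a + 1 + (b + 1) = a + (b + 1) + 1 by omega] at h4
  refine mul_left_cancel₀ ha ?_
  linear_combination h1 - X ^ (a + 1) * h3 + X ^ (a + 1) * h2 + qMultichoose a (b + 1) * h4

/-- From q-Pascal, with `(X ^ (b + 1) - 1) * qMultichoose a (b + 1)` rewritten by absorption. The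
remaining coefficient depends on `a + b` only, so shifted solutions can be combined linearly. -/
lemma qMultichoose_recurrence (a b : ℕ) :
    qMultichoose (a + 1) (b + 1) = qMultichoose (a + 1) b + qMultichoose a (b + 1) +
      (X ^ (a + b + 1) - 1) * qMultichoose a b := by
  linear_combination qMultichoose_succ_succ a b + (X - 1) * qInt_mul_qMultichoose_right a b
    - qMultichoose a (b + 1) * X_sub_one_mul_qInt (b + 1)
    + qMultichoose a b * X_sub_one_mul_qInt (a + b + 1)

lemma qBinom_eq_qMultichoose (a b : ℕ) : qBinom (a + b) (b : ℤ) = qMultichoose a b := by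
  simp [qBinom, qMultichoose, mul_comm]

/-! ### Inserting the letters `D` -/

section Shuffle

open Step

variable [LinearOrder Step]

lemma descentWeight_self (x : Step) (l : ℕ) : descentWeight (some x) x l = 1 := by
  simp [descentWeight]

/-- Here `y` is the last letter other than `D` before a final `x`; the two terms on the left have
`D` or `y` just before `x`. For each relative order of `x`, `y`, `D` this is a multiple of one of
the two q-Pascal rules. -/
lemma insertD_identity {x y : Step} (hx : x ≠ D) (hy : y ≠ D) (k d : ℕ) :
    descentWeight (some D) x (k + 1 + (d + 1)) * (if y < D then 1 else X ^ (k + 1)) *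
        qMultichoose (k + 1) d +
      descentWeight (some y) x (k + 1 + (d + 1)) * (if y < D then X ^ (d + 1) else 1) *
        qMultichoose k (d + 1) =
      descentWeight (some y) x (k + 1) * (if x < D then X ^ (d + 1) else 1) *
        qMultichoose (k + 1) (d + 1) := by
  have h1 := qMultichoose_succ_succ k d
  have h2 := qMultichoose_succ_succ' k d
  simp only [descentWeight]
  rcases lt_or_gt_of_ne hx with hx | hx <;> rcases lt_or_gt_of_ne hy with hy | hy
  · by_cases hxy : x < y
    · simp only [hx, hy, hxy, if_true, pow_add] at h1 h2 ⊢
      linear_combination (-X ^ k * X ^ d * X * X) * h1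
    · simp only [hx, hy, hxy, if_true, if_false, pow_add] at h1 h2 ⊢
      linear_combination (-X ^ d * X) * h2
  · simp only [hx, hx.trans hy, hy.not_gt, if_true, if_false, pow_add] at h1 h2 ⊢
    linear_combination (-X ^ k * X ^ d * X * X) * h2
  · simp only [hx.not_gt, (hy.trans hx).not_gt, hy, if_true, if_false, pow_add] at h1 h2 ⊢
    linear_combination -h1
  · by_cases hxy : x < y
    · simp only [hx.not_gt, hy.not_gt, hxy, if_true, if_false, pow_add] at h1 h2 ⊢
      linear_combination (-X ^ k * X) * h1
    · simp only [hx.not_gt, hy.not_gt, hxy, if_false, pow_add] at h1 h2 ⊢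
      linear_combination -h2

lemma appendD_identity {y : Step} (hy : y ≠ D) (k d : ℕ) :
    (if y < D then 1 else X ^ (k + 1)) * qMultichoose (k + 1) d +
      descentWeight (some y) D (k + 1 + (d + 1)) * (if y < D then X ^ (d + 1) else 1) *
        qMultichoose k (d + 1) =
      (if y < D then 1 else X ^ (k + 1)) * qMultichoose (k + 1) (d + 1) := by
  have h1 := qMultichoose_succ_succ k d
  simp only [descentWeight]
  rcases lt_or_gt_of_ne hy with hy | hy
  · simp only [hy, hy.not_gt, if_true, if_false, pow_add] at h1 ⊢
    linear_combination -h1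
  · simp only [hy, hy.not_gt, if_true, if_false, pow_add] at h1 ⊢
    linear_combination (-X ^ k * X) * h1

/-- Words with `a + b = k + 1` letters different from `D`: the letters `D` can be inserted
independently of the rest of the word. -/
def DFactors (k a b : ℕ) : Prop :=
  (∀ d, contentSum (some E) a b d =
    contentSum (some E) a b 0 * (if E < D then X ^ d else 1) * qMultichoose k d) ∧
  (∀ d, contentSum (some N) a b d =
    contentSum (some N) a b 0 * (if N < D then X ^ d else 1) * qMultichoose k d) ∧
  ∀ d, contentSum (some D) a b (d + 1) =
    (contentSum (some E) a b 0 * (if E < D then 1 else X ^ (k + 1)) +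
      contentSum (some N) a b 0 * (if N < D then 1 else X ^ (k + 1))) * qMultichoose (k + 1) d

lemma dFactors_of_E_N {k a b : ℕ} (hk : a + b = k + 1)
    (hE : ∀ d, contentSum (some E) a b d =
      contentSum (some E) a b 0 * (if E < D then X ^ d else 1) * qMultichoose k d)
    (hN : ∀ d, contentSum (some N) a b d =
      contentSum (some N) a b 0 * (if N < D then X ^ d else 1) * qMultichoose k d) :
    DFactors k a b := by
  refine ⟨hE, hN, fun d => ?_⟩
  induction d with
  | zero =>
    rw [contentSum_D_succ, sum_option_step, contentSum_none (by omega), contentSum_D_zero, hk,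
      qMultichoose_zero_right]
    have h : ∀ y : Step, y ≠ D →
        descentWeight (some y) D (k + 1 + 0) = if y < D then 1 else X ^ (k + 1) := by
      intro y hy
      rcases lt_or_gt_of_ne hy with hy | hy <;> simp [descentWeight, hy, hy.not_gt]
    rw [h E (by simp), h N (by simp)]
    ring
  | succ d ih =>
    rw [contentSum_D_succ, sum_option_step, contentSum_none (by omega), hE (d + 1), hN (d + 1),
      ih, hk, descentWeight_self]
    linear_combination contentSum (some E) a b 0 * appendD_identity (y := E) (by simp) k d +
      contentSum (some N) a b 0 * appendD_identity (y := N) (by simp) k d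

/-- Appending `x ≠ D` preserves the factorization: compare the coefficients of the `D`-free sums
ending in `E` and in `N`. -/
lemma DFactors.sum_insert {k a b : ℕ} (hk : a + b = k + 1) (h : DFactors k a b) {x : Step}
    (hx : x ≠ D) (d : ℕ) :
    ∑ o, descentWeight o x (a + b + d) * contentSum o a b d =
      (∑ o, descentWeight o x (a + b + 0) * contentSum o a b 0) *
        (if x < D then X ^ d else 1) * qMultichoose (k + 1) d := by
  obtain ⟨hE, hN, hD⟩ := h
  cases d with
  | zero => simp [qMultichoose_zero_right]
  | succ d =>
    rw [sum_option_step, sum_option_step, contentSum_none (by omega), contentSum_none (by omega),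
      hE (d + 1), hN (d + 1), hD, hk, contentSum_D_zero]
    linear_combination
      contentSum (some E) a b 0 * insertD_identity hx (y := E) (by simp) k d +
      contentSum (some N) a b 0 * insertD_identity hx (y := N) (by simp) k d

lemma contentSum_D_zero_zero (d : ℕ) : contentSum (some D) 0 0 (d + 1) = 1 := by
  induction d with
  | zero => simp [contentSum_D_succ, contentSum_zero, descentWeight]
  | succ d ih =>
    rw [contentSum_D_succ, sum_option_step, contentSum_none (by omega), contentSum_E_zero,
      contentSum_N_zero, ih, descentWeight_self]
    ring

lemma contentSum_E_one_zero (d : ℕ) :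
    contentSum (some E) 1 0 d = if E < D then X ^ d else 1 := by
  rw [← zero_add 1, contentSum_E_succ, sum_option_step, contentSum_E_zero, contentSum_N_zero]
  cases d with
  | zero => simp [contentSum_zero, descentWeight]
  | succ d => simp [contentSum_none, contentSum_D_zero_zero, descentWeight]

lemma dFactors : ∀ k a b : ℕ, a + b = k + 1 → DFactors k a b := by
  intro k
  induction k with
  | zero =>
    intro a b hk
    obtain ⟨rfl, rfl⟩ | ⟨rfl, rfl⟩ : a = 1 ∧ b = 0 ∨ a = 0 ∧ b = 1 := by omega
    · exact dFactors_of_E_N hk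
        (fun d => by simp [contentSum_E_one_zero, qMultichoose_zero_left])
        (fun d => by simp [contentSum_N_zero])
    · simp [DFactors, contentSum_eq_zero]
  | succ k ih =>
    intro a b hk
    refine dFactors_of_E_N hk (fun d => ?_) (fun d => ?_)
    · rcases a with _ | a
      · simp [contentSum_E_zero]
      · rw [contentSum_E_succ, contentSum_E_succ,
          (ih a b (by omega)).sum_insert (by omega) (by simp)]
    · rcases b with _ | b
      · simp [contentSum_N_zero]
      · rw [contentSum_N_succ, contentSum_N_succ]
        -- The ballot condition does not involve `d`, so it holds or fails on both sides together.
        by_cases hba : b + 1 ≤ a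
        · rw [if_pos hba, if_pos hba, (ih a b (by omega)).sum_insert (by omega) (by simp)]
        · simp [hba]

lemma sum_contentSum_eq_mul (a b d : ℕ) :
    ∑ o, contentSum o a b d = (∑ o, contentSum o a b 0) * qMultichoose (a + b) d := by
  rcases hk : a + b with _ | k
  · obtain ⟨rfl, rfl⟩ : a = 0 ∧ b = 0 := by omega
    cases d with
    | zero => simp [qMultichoose_zero_right]
    | succ d =>
      rw [sum_option_step, sum_option_step]
      simp [contentSum_zero, contentSum_none, contentSum_E_zero, contentSum_N_zero,
        contentSum_D_zero_zero, qMultichoose_zero_left]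
  · obtain ⟨hE, hN, hD⟩ := dFactors k a b hk
    cases d with
    | zero => simp [qMultichoose_zero_right]
    | succ d =>
      rw [sum_option_step, sum_option_step, contentSum_none (by omega),
        contentSum_none (by omega), hE (d + 1), hN (d + 1), hD, contentSum_D_zero]
      -- The factors for words ending in `y` and in `D` add up by q-Pascal to one that no longer
      -- depends on the order.
      have h : ∀ y : Step,
          (if y < D then X ^ (d + 1) else 1) * qMultichoose k (d + 1) +
            (if y < D then 1 else X ^ (k + 1)) * qMultichoose (k + 1) d =
              qMultichoose (k + 1) (d + 1) := by
        intro y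
        split_ifs
        · linear_combination -qMultichoose_succ_succ k d
        · linear_combination -qMultichoose_succ_succ' k d
      linear_combination contentSum (some E) a b 0 * h E + contentSum (some N) a b 0 * h N

end Shuffle

/-! ### Closed form for ballot words -/

/-- The ballot analogue of `qMultichoose`, from the reflection principle. -/
noncomputable def qBallot (c : RatFunc ℚ) (a : ℕ) : ℕ → RatFunc ℚ
  | 0 => 1
  | b + 1 => qMultichoose a (b + 1) - c * qMultichoose (a + 1) b

/-- The reflected term sits at `(a + 1, b - 1)`, with the same sum, so it obeys the same recurrence.
-/
lemma qBallot_recurrence (c : RatFunc ℚ) (a b : ℕ) :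
    qBallot c (a + 1) (b + 1) = qBallot c (a + 1) b + qBallot c a (b + 1) +
      (X ^ (a + b + 1) - 1) * qBallot c a b := by
  cases b with
  | zero =>
    have h := qMultichoose_recurrence a 0
    simp only [qBallot, qMultichoose_zero_right] at h ⊢
    linear_combination h
  | succ b =>
    have h := qMultichoose_recurrence a (b + 1)
    have h' := qMultichoose_recurrence (a + 1) b
    simp only [qBallot]
    rw [show a + 1 + b + 1 = a + (b + 1) + 1 by omega] at h'
    linear_combination h - c * h'

lemma qInt_mul_qBallot_diag (c : RatFunc ℚ) (a : ℕ) :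
    qInt (a + 1) * qBallot c a a = (qInt (a + 1) - c * qInt a) * qMultichoose a a := by
  cases a with
  | zero => simp [qBallot, qMultichoose_zero_right, qInt]
  | succ a =>
    have h1 := qInt_mul_qMultichoose_left (a + 1) a
    have h2 := qInt_mul_qMultichoose_right (a + 1) a
    simp only [qBallot]
    linear_combination c * h2 - c * h1

lemma qInt_mul_qBallot_X_diag (a : ℕ) : qInt (a + 1) * qBallot X a a = qMultichoose a a := by
  rw [qInt_mul_qBallot_diag]
  linear_combination qMultichoose a a * (qInt_succ a - X_sub_one_mul_qInt a)

lemma qInt_mul_qBallot_one_diag (a : ℕ) :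
    qInt (a + 1) * qBallot 1 a a = X ^ a * qMultichoose a a := by
  rw [qInt_mul_qBallot_diag, qInt_succ]
  ring

/-- Boundary condition for `N < E`: the solution vanishes just above the diagonal. -/
lemma qBallot_one_succ (a : ℕ) : qBallot 1 a (a + 1) = 0 := by
  have ha := qInt_ne_zero (Nat.succ_ne_zero a)
  refine (mul_eq_zero.1 (?_ : qInt (a + 1) * _ = 0)).resolve_left ha
  simp only [qBallot]
  linear_combination qInt_mul_qMultichoose_right a a - qInt_mul_qMultichoose_left a a

/-- Boundary condition for `E < N`, matching `sum_contentSum_diag_of_lt`. -/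
lemma qBallot_X_succ (a : ℕ) :
    qBallot X (a + 1) (a + 1) = qBallot X (a + 1) a := by
  have ha := qInt_ne_zero (Nat.succ_ne_zero a)
  have h : qBallot X a (a + 1) + (X ^ (a + a + 1) - 1) * qBallot X a a = 0 := by
    refine (mul_eq_zero.1 (?_ : qInt (a + 1) * _ = 0)).resolve_left ha
    have h1 := qInt_mul_qMultichoose_right a a
    have h2 := qInt_mul_qMultichoose_left a a
    have h3 := qInt_mul_qBallot_X_diag a
    have h4 := X_sub_one_mul_qInt (a + a + 1)
    simp only [qBallot.eq_2]
    linear_combination h1 - X * h2 + (X ^ (a + a + 1) - 1) * h3 - qMultichoose a a * h4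
  linear_combination qBallot_recurrence X a a + h

/-! ### Ballot words without `D` -/

section Ballot

open Step

variable [LinearOrder Step]

lemma sum_contentSum_zero_right (a : ℕ) : ∑ o, contentSum o a 0 0 = 1 := by
  induction a with
  | zero => simp [contentSum_zero]
  | succ a ih =>
    rw [sum_option_step] at ih ⊢
    rw [contentSum_none (by omega), contentSum_N_zero, contentSum_D_zero, contentSum_E_succ,
      sum_option_step, ← ih, contentSum_N_zero, contentSum_D_zero, descentWeight_self]
    simp [descentWeight]

lemma sum_contentSum_eq_zero {a b : ℕ} (h : a < b) : ∑ o, contentSum o a b 0 = 0 :=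
  Finset.sum_eq_zero fun o _ => contentSum_eq_zero h o 0

/-- A letter appended to a word without `D` creates no descent. -/
lemma sum_descentWeight_of_forall_not_lt {x : Step} (hE : ¬ x < E) (hN : ¬ x < N) (a b l : ℕ) :
    ∑ o, descentWeight o x l * contentSum o a b 0 = ∑ o, contentSum o a b 0 := by
  rw [sum_option_step, sum_option_step]
  simp [contentSum_D_zero, descentWeight, hE, hN]

lemma contentSum_E_of_gt (h : N < E) (a b : ℕ) :
    contentSum (some E) (a + 1) b 0 = ∑ o, contentSum o a b 0 := by
  rw [contentSum_E_succ, sum_descentWeight_of_forall_not_lt (lt_irrefl _) h.not_gt]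

lemma contentSum_N_of_lt (h : E < N) {a b : ℕ} (hab : b + 1 ≤ a) :
    contentSum (some N) a (b + 1) 0 = ∑ o, contentSum o a b 0 := by
  rw [contentSum_N_succ, if_pos hab,
    sum_descentWeight_of_forall_not_lt h.not_gt (lt_irrefl _)]

/-- Only a final `EN` gives a new descent, of size `a + b + 1`. Words ending in `E` at `(a + 1, b)`
have the total of `(a, b)`, whence the correction term. -/
lemma sum_contentSum_recurrence_of_gt (h : N < E) {a b : ℕ} (hab : b ≤ a) :
    ∑ o, contentSum o (a + 1) (b + 1) 0 =
      ∑ o, contentSum o (a + 1) b 0 + ∑ o, contentSum o a (b + 1) 0 +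
        (X ^ (a + b + 1) - 1) * ∑ o, contentSum o a b 0 := by
  have hE := contentSum_E_of_gt h a b
  have hE' := contentSum_E_of_gt h a (b + 1)
  have hN := contentSum_N_succ (a + 1) b 0
  rw [if_pos (by omega), sum_option_step] at hN
  rw [sum_option_step, hE', hN, contentSum_D_zero, contentSum_none (by omega),
    contentSum_none (by omega), sum_option_step (fun o => contentSum o (a + 1) b 0),
    contentSum_none (by omega), contentSum_D_zero, contentSum_D_zero, descentWeight_self, ← hE]
  simp only [descentWeight, h, if_true]
  ring

/-- Now the descent is a final `NE`. Its `N` must end at `(a, b + 1)` on or below the diagonal, so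
the diagonal case is separate. -/
lemma sum_contentSum_recurrence_of_lt (h : E < N) {a b : ℕ} (hab : b + 1 ≤ a) :
    ∑ o, contentSum o (a + 1) (b + 1) 0 =
      ∑ o, contentSum o (a + 1) b 0 + ∑ o, contentSum o a (b + 1) 0 +
        (X ^ (a + b + 1) - 1) * ∑ o, contentSum o a b 0 := by
  have hN := contentSum_N_of_lt h hab
  have hN' := contentSum_N_of_lt h (show b + 1 ≤ a + 1 by omega)
  have hE := contentSum_E_succ a (b + 1) 0
  rw [sum_option_step] at hE
  rw [sum_option_step, hN', hE, contentSum_D_zero, contentSum_none (by omega),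
    contentSum_none (by omega), sum_option_step (fun o => contentSum o a (b + 1) 0),
    contentSum_none (by omega), contentSum_D_zero, contentSum_D_zero, descentWeight_self, ← hN]
  simp only [descentWeight, h, if_true]
  ring

lemma sum_contentSum_diag_of_lt (h : E < N) (a : ℕ) :
    ∑ o, contentSum o (a + 1) (a + 1) 0 = ∑ o, contentSum o (a + 1) a 0 := by
  have hE := contentSum_E_succ a (a + 1) 0
  simp only [contentSum_eq_zero (Nat.lt_succ_self a), mul_zero, Finset.sum_const_zero] at hE
  rw [sum_option_step, contentSum_N_of_lt h le_rfl, hE, contentSum_D_zero,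
    contentSum_none (by omega)]
  ring

lemma sum_contentSum_of_lt (h : E < N) :
    ∀ a b : ℕ, b ≤ a → ∑ o, contentSum o a b 0 = qBallot X a b := by
  intro a
  induction a with
  | zero =>
    intro b hb
    obtain rfl : b = 0 := by omega
    exact sum_contentSum_zero_right 0
  | succ a iha =>
    intro b
    induction b with
    | zero => exact fun _ => sum_contentSum_zero_right _
    | succ b ihb =>
      intro hb
      rcases (Nat.succ_le_succ_iff.1 hb).eq_or_lt with rfl | hlt
      · rw [sum_contentSum_diag_of_lt h, qBallot_X_succ, ihb (by omega)]
      · rw [sum_contentSum_recurrence_of_lt h hlt, qBallot_recurrence, ihb (by omega),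
          iha _ hlt, iha _ (by omega)]

lemma sum_contentSum_of_gt (h : N < E) :
    ∀ a b : ℕ, b ≤ a → ∑ o, contentSum o a b 0 = qBallot 1 a b := by
  intro a
  induction a with
  | zero =>
    intro b hb
    obtain rfl : b = 0 := by omega
    exact sum_contentSum_zero_right 0
  | succ a iha =>
    -- The recurrence at `(a + 1, a + 1)` uses the value at `(a, a + 1)`, where both sides are zero.
    have iha' : ∀ b ≤ a + 1, ∑ o, contentSum o a b 0 = qBallot 1 a b := by
      intro b hb
      rcases hb.eq_or_lt with rfl | hlt
      · rw [sum_contentSum_eq_zero (Nat.lt_succ_self a), qBallot_one_succ]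
      · exact iha b (by omega)
    intro b
    induction b with
    | zero => exact fun _ => sum_contentSum_zero_right _
    | succ b ihb =>
      intro hb
      rw [sum_contentSum_recurrence_of_gt h (by omega), qBallot_recurrence, ihb (by omega),
        iha' _ hb, iha _ (by omega)]

end Ballot

lemma MSch_eq_mul [LinearOrder Step] (e d : ℕ) :
    MSch (e + d) (e + e + d) = (∑ o, contentSum o e e 0) * qMultichoose (e + e) d := by
  rw [MSch_eq_sum_ballotSum, ← sum_contentSum_eq_mul]
  simp [contentSum]

lemma MSch_eq_zero [LinearOrder Step] {n l : ℕ} (h : 2 * n < l) : MSch n l = 0 := by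
  rw [MSch_eq_sum_ballotSum]
  exact Finset.sum_eq_zero fun o _ => ballotSum_eq_zero (by simp; omega) o

end Schroeder

theorem theorem1p1 [LinearOrder Schroeder.Step] (n l : ℕ) (hnl : n ≤ l) :
    (Schroeder.Step.E < Schroeder.Step.N →
      Schroeder.MSch n l =
        1 / Schroeder.qInt (l - n + 1) *
          Schroeder.qBinom (2 * (l - n)) ((l : ℤ) - (n : ℤ)) *
          Schroeder.qBinom l (2 * (n : ℤ) - (l : ℤ))) ∧
    (Schroeder.Step.N < Schroeder.Step.E →
      Schroeder.MSch n l =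
        RatFunc.X ^ (l - n) / Schroeder.qInt (l - n + 1) *
          Schroeder.qBinom (2 * (l - n)) ((l : ℤ) - (n : ℤ)) *
          Schroeder.qBinom l (2 * (n : ℤ) - (l : ℤ))) := by
  -- If `2 * n < l` there are no paths, and the second q-binomial has a negative lower index.
  rcases Nat.lt_or_ge (2 * n) l with h | h
  · have h0 : Schroeder.qBinom l (2 * (n : ℤ) - (l : ℤ)) = 0 := if_neg (by omega)
    simp [h0, Schroeder.MSch_eq_zero h]
  · obtain ⟨e, rfl⟩ := Nat.exists_eq_add_of_le hnl
    obtain ⟨d, rfl⟩ : ∃ d, n = e + d := Nat.exists_eq_add_of_le (by omega)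
    have he : e + d + e - (e + d) = e := by omega
    have he' : ((e + d + e : ℕ) : ℤ) - ((e + d : ℕ) : ℤ) = e := by push_cast; ring
    have hd : 2 * ((e + d : ℕ) : ℤ) - ((e + d + e : ℕ) : ℤ) = d := by push_cast; ring
    have hi := Schroeder.qInt_ne_zero (Nat.succ_ne_zero e)
    rw [he, he', hd, two_mul, Schroeder.qBinom_eq_qMultichoose,
      show e + d + e = e + e + d by omega, Schroeder.qBinom_eq_qMultichoose,
      Schroeder.MSch_eq_mul]
    constructor
    · intro h
      rw [Schroeder.sum_contentSum_of_lt h e e le_rfl, ← Schroeder.qInt_mul_qBallot_X_diag e]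
      field_simp
    · intro h
      rw [Schroeder.sum_contentSum_of_gt h e e le_rfl, div_mul_eq_mul_div,
        ← Schroeder.qInt_mul_qBallot_one_diag e]
      field_simp
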